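/- **Lemma 3.1.** Let $p,n\ge 0$ be integers, let $A\in\mathbb R^{n\times p}$, let $\Sigma_\Theta\in\mathbb R^{p\times p}$ be symmetric positive semidefinite and $\Sigma_\varepsilon\in\mathbb R^{n\times n}$ symmetric positive definite. Let $\Theta\sim N(0,\Sigma_\Theta)$ in $\mathbb R^p$ and $\varepsilon\sim N(0,\Sigma_\varepsilon)$ in $\mathbb R^n$ be independent random vectors on a common probability space, and set $Y=A\Theta+\varepsilon$. Write $I(\Theta;Y)=\mathrm{KL}\big(P_{\Theta,Y}\,\|\,P_\Theta\otimes P_Y\big)\in[0,\infty]$ for the mutual information, where $P_{\Theta,Y}$ is the joint law and $P_\Theta,P_Y$ are its marginals. Then $(\Theta,Y)$ is jointly Gaussian, $I(\Theta;Y)$ is finite, the two determinants below are positive, and $$I(\Theta;Y)=\tfrac12\log\det\big(I_n+A\Sigma_\Theta A^\top\Sigma_\varepsilon^{-1}\big)=\tfrac12\log\det\big(I_p+\Sigma_\Theta A^\top\Sigma_\varepsilon^{-1}A\big).$$ Moreover, the matrix $\Sigma_\varepsilon^{-1/2}A\Sigma_\Theta A^\top\Sigma_\varepsilon^{-1/2}$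 is symmetric, its nonzero eigenvalues, counted with multiplicity, are positive and exactly $r=\mathrm{rank}(A\Sigma_\Theta^{1/2})$ in number, and, denoting them by $\lambda_1,\dots,\lambda_r$, $$I(\Theta;Y)=\tfrac12\sum_{j=1}^r\log(1+\lambda_j).$$ -/

import Mathlib

open MeasureTheory ProbabilityTheory InformationTheory
open scoped Matrix MatrixOrder ENNReal

/-- The mutual information `I(X; Y)` of two random variables: the Kullback–Leibler divergence of
the joint law of `(X, Y)` from the product of the marginal laws (`∞` if the joint law is not
absolutely continuous, or if the log-density is not integrable). -/
noncomputable def mutualInfo {Ω E F : Type*} [MeasurableSpace Ω] [MeasurableSpace E]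
    [MeasurableSpace F] (X : Ω → E) (Y : Ω → F) (P : Measure Ω) : ℝ≥0∞ :=
  klDiv (P.map (fun ω => (X ω, Y ω))) ((P.map X).prod (P.map Y))

/-- The matrix `Σε^{-1/2} A ΣΘ Aᵀ Σε^{-1/2}`, where `Σε^{-1/2}` is the inverse of the positive
semidefinite square root of `Σε`. -/
noncomputable def whitenedSignalCov {p n : ℕ} (A : Matrix (Fin n) (Fin p) ℝ)
    (SΘ : Matrix (Fin p) (Fin p) ℝ) (Sε : Matrix (Fin n) (Fin n) ℝ) :
    Matrix (Fin n) (Fin n) ℝ :=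
  (CFC.sqrt Sε)⁻¹ * A * SΘ * Aᵀ * (CFC.sqrt Sε)⁻¹

/-! Given `Θ = x`, the vector `Y` is Gaussian with mean `A x` and covariance `Sε`. Hence the joint
law has density `g_ε(y - A x) / g_Y(y)` with respect to the product of the marginals, where `g_Y` is
the density for `A * SΘ * Aᵀ + Sε`. Only the noise and `Y` need Lebesgue densities, so `SΘ` may be
singular.

At `(Θ, Y)` the logarithm of this density is half the difference of the log-determinants of the two
covariances, plus half the difference of the quadratic forms of `Y` and `ε` in their inverse
covariances. Each form has mean `n`, so only the determinants survive (`mutualInfo_mulVec_add`).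

The rest is linear algebra: `det (1 + M N) = det (1 + N M)` relates the three determinants, and the
whitened matrix is `C Cᴴ` with `C = Sε^{-1/2} A SΘ^{1/2}`, which gives positivity and the rank. -/

theorem Matrix.PosDef.isUnit_det_sqrt {ι : Type*} [Fintype ι] [DecidableEq ι]
    {S : Matrix ι ι ℝ} (hS : S.PosDef) : IsUnit (CFC.sqrt S).det := by
  rw [hS.posSemidef.det_sqrt, isUnit_iff_ne_zero, RCLike.sqrt_of_nonneg hS.posSemidef.det_nonneg]
  simpa using (Real.sqrt_pos.2 hS.det_pos).ne'

theorem Matrix.PosSemidef.det_sqrt_real {ι : Type*} [Fintype ι] [DecidableEq ι]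
    {S : Matrix ι ι ℝ} (hS : S.PosSemidef) : (CFC.sqrt S).det = √S.det := by
  rw [hS.det_sqrt, RCLike.sqrt_of_nonneg hS.det_nonneg]
  simp

theorem Matrix.PosSemidef.inv_sqrt_mul_inv_sqrt {ι : Type*} [Fintype ι] [DecidableEq ι]
    {S : Matrix ι ι ℝ} (hS : S.PosSemidef) : (CFC.sqrt S)⁻¹ * (CFC.sqrt S)⁻¹ = S⁻¹ := by
  rw [← Matrix.mul_inv_rev, CFC.sqrt_mul_sqrt_self _ hS.nonneg]

/-! ### Densities and quadratic moments of Gaussian laws -/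

namespace ProbabilityTheory

/-- The standard Gaussian measure has density `(2π)^(-d/2) exp(-‖x‖²/2)`. -/
theorem stdGaussian_eq_withDensity (E : Type*) [NormedAddCommGroup E] [InnerProductSpace ℝ E]
    [FiniteDimensional ℝ E] [MeasurableSpace E] [BorelSpace E] :
    stdGaussian E = volume.withDensity (fun x : E =>
      ENNReal.ofReal (((2 * Real.pi) ^ (Module.finrank ℝ E / 2 : ℝ))⁻¹ *
        Real.exp (-(‖x‖ ^ 2 / 2)))) := by
  have hint : Integrable (fun x : E => ((2 * Real.pi) ^ (Module.finrank ℝ E / 2 : ℝ))⁻¹ *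
        Real.exp (-(‖x‖ ^ 2 / 2))) := by
    have := (GaussianFourier.integrable_cexp_neg_mul_sq_norm_add (V := E) (b := 1 / 2)
      (by norm_num) 0 0).norm
    refine (this.congr (.of_forall fun x => ?_)).const_mul _
    simp only [Complex.norm_exp]
    congr 1
    simp [← Complex.ofReal_pow]
    ring
  have hfin : IsFiniteMeasure (volume.withDensity (fun x : E =>
      ENNReal.ofReal (((2 * Real.pi) ^ (Module.finrank ℝ E / 2 : ℝ))⁻¹ *
        Real.exp (-(‖x‖ ^ 2 / 2))))) := isFiniteMeasure_withDensity_ofReal hint.2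
  -- Finite measures are determined by their characteristic functions; that of the density is the
  -- Gaussian Fourier integral with `b = 1/2` and `c = I`.
  refine Measure.ext_of_charFun (funext fun t => ?_)
  rw [charFun_stdGaussian, charFun_apply, integral_withDensity_eq_integral_toReal_smul
    (by fun_prop) (by simp)]
  have hpos : (0 : ℝ) < (2 * Real.pi) ^ (Module.finrank ℝ E / 2 : ℝ) := by positivity
  have h (x : E) : (ENNReal.ofReal (((2 * Real.pi) ^ (Module.finrank ℝ E / 2 : ℝ))⁻¹ *
        Real.exp (-(‖x‖ ^ 2 / 2)))).toReal • Complex.exp (inner ℝ x t * Complex.I) =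
      (((2 * Real.pi) ^ (Module.finrank ℝ E / 2 : ℝ) : ℝ) : ℂ)⁻¹ *
        Complex.exp (-(1 / 2 : ℂ) * ‖x‖ ^ 2 + Complex.I * inner ℝ t x) := by
    rw [ENNReal.toReal_ofReal (by positivity), Complex.real_smul, Complex.exp_add]
    push_cast
    rw [real_inner_comm, mul_comm Complex.I, mul_assoc]
    ring_nf
  simp_rw [h]
  rw [integral_const_mul, GaussianFourier.integral_cexp_neg_mul_sq_norm_add (by norm_num)]
  rw [Complex.ofReal_cpow (by positivity)]
  push_cast
  rw [show (Real.pi / (1 / 2) : ℂ) = 2 * Real.pi by ring, ← mul_assoc, inv_mul_cancel₀, one_mul]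
  · congr 1
    rw [Complex.I_sq]
    ring
  · have := Complex.ofReal_ne_zero.2 hpos.ne'
    rw [Complex.ofReal_cpow (by positivity)] at this
    push_cast at this
    exact this

/-- The density of the centred multivariate Gaussian measure with covariance matrix `S`. -/
noncomputable def multivariateGaussianDensity {ι : Type*} [Fintype ι] [DecidableEq ι]
    (S : Matrix ι ι ℝ) (y : EuclideanSpace ℝ ι) : ℝ :=
  ((2 * Real.pi) ^ (Fintype.card ι / 2 : ℝ))⁻¹ * (√S.det)⁻¹ *
    Real.exp (-((y.ofLp ⬝ᵥ S⁻¹ *ᵥ y.ofLp) / 2))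

theorem multivariateGaussianDensity_pos {ι : Type*} [Fintype ι] [DecidableEq ι]
    {S : Matrix ι ι ℝ} (hS : S.PosDef) (y : EuclideanSpace ℝ ι) :
    0 < multivariateGaussianDensity S y := by
  have := Real.sqrt_pos.2 hS.det_pos
  unfold multivariateGaussianDensity
  positivity

theorem measurable_dotProduct_mulVec {ι : Type*} [Fintype ι]
    (B : Matrix ι ι ℝ) : Measurable fun y : EuclideanSpace ℝ ι => y.ofLp ⬝ᵥ B *ᵥ y.ofLp := by
  unfold dotProduct Matrix.mulVec dotProduct
  fun_prop

theorem measurable_multivariateGaussianDensity {ι : Type*} [Fintype ι] [DecidableEq ι]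
    (S : Matrix ι ι ℝ) : Measurable (multivariateGaussianDensity S) := by
  unfold multivariateGaussianDensity
  have := measurable_dotProduct_mulVec S⁻¹
  fun_prop

/-- The law is the image of the standard Gaussian under `√S`, so this is a linear change of
variables with Jacobian `det √S = √(det S)`. -/
theorem multivariateGaussian_eq_withDensity {ι : Type*} [Fintype ι] [DecidableEq ι]
    {S : Matrix ι ι ℝ} (hS : S.PosDef) :
    multivariateGaussian 0 S =
      volume.withDensity (fun y => ENNReal.ofReal (multivariateGaussianDensity S y)) := by
  set R := CFC.sqrt S with hR
  have hRu : IsUnit R.det := hS.isUnit_det_sqrt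
  have hRdet : R.det = √S.det := hS.posSemidef.det_sqrt_real
  have hRpos : 0 < R.det := hRdet ▸ Real.sqrt_pos.2 hS.det_pos
  have hRh : R⁻¹ᵀ = R⁻¹ := by
    have : R.IsHermitian := (Matrix.nonneg_iff_posSemidef.1 (CFC.sqrt_nonneg S)).isHermitian
    simpa using this.inv.eq
  set T := Matrix.toEuclideanCLM (𝕜 := ℝ) (n := ι) R with hT
  have hdet : LinearMap.det (T : EuclideanSpace ℝ ι →ₗ[ℝ] EuclideanSpace ℝ ι) = R.det := by
    rw [hT, Matrix.coe_toEuclideanCLM_eq_toEuclideanLin, Matrix.toEuclideanLin_eq_toLin_orthonormal,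
      LinearMap.det_toLin]
  have hmap : Measure.map T (volume : Measure (EuclideanSpace ℝ ι)) =
      ENNReal.ofReal (R.det)⁻¹ • volume := by
    have := Measure.map_linearMap_addHaar_eq_smul_addHaar (volume : Measure (EuclideanSpace ℝ ι))
      (f := (T : EuclideanSpace ℝ ι →ₗ[ℝ] EuclideanSpace ℝ ι)) (hdet ▸ hRpos.ne')
    rw [hdet, abs_of_pos (inv_pos.2 hRpos)] at this
    exact this
  have hquad (x : EuclideanSpace ℝ ι) :
      (T x).ofLp ⬝ᵥ S⁻¹ *ᵥ (T x).ofLp = ‖x‖ ^ 2 := by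
    rw [hT, Matrix.ofLp_toEuclideanCLM, ← hS.posSemidef.inv_sqrt_mul_inv_sqrt, ← hR,
      ← Matrix.mulVec_mulVec, Matrix.mulVec_mulVec _ R⁻¹ R, Matrix.nonsing_inv_mul _ hRu,
      Matrix.one_mulVec, Matrix.dotProduct_mulVec, ← Matrix.mulVec_transpose, hRh,
      Matrix.mulVec_mulVec, Matrix.nonsing_inv_mul _ hRu, Matrix.one_mulVec,
      EuclideanSpace.real_norm_sq_eq]
    simp [dotProduct, sq]
  have hdens (x : EuclideanSpace ℝ ι) :
      ENNReal.ofReal (((2 * Real.pi) ^ (Module.finrank ℝ (EuclideanSpace ℝ ι) / 2 : ℝ))⁻¹ *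
        Real.exp (-(‖x‖ ^ 2 / 2))) =
      ENNReal.ofReal R.det * ENNReal.ofReal (multivariateGaussianDensity S (T x)) := by
    rw [multivariateGaussianDensity, hquad, ← ENNReal.ofReal_mul hRpos.le, ← hRdet,
      finrank_euclideanSpace]
    congr 1
    field_simp
  have hm := measurable_multivariateGaussianDensity S
  refine Measure.ext_of_lintegral _ fun f hf => ?_
  rw [multivariateGaussian, lintegral_map hf (by fun_prop), stdGaussian_eq_withDensity,
    lintegral_withDensity_eq_lintegral_mul _ (by fun_prop) (by fun_prop),
    lintegral_withDensity_eq_lintegral_mul _ (by fun_prop) hf]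
  simp only [Pi.mul_apply, hdens, zero_add, ← hR, ← hT]
  have h1 : ∫⁻ x, (fun y => ENNReal.ofReal (multivariateGaussianDensity S y) * f y) (T x) =
      ∫⁻ y, ENNReal.ofReal (multivariateGaussianDensity S y) * f y
        ∂(Measure.map T (volume : Measure (EuclideanSpace ℝ ι))) :=
    (lintegral_map (f := fun y => ENNReal.ofReal (multivariateGaussianDensity S y) * f y)
      (by fun_prop) (by fun_prop)).symm
  simp_rw [mul_assoc]
  rw [lintegral_const_mul _ (by fun_prop), h1, hmap, lintegral_smul_measure, smul_eq_mul,
    ← mul_assoc, ← ENNReal.ofReal_mul hRpos.le, mul_inv_cancel₀ hRpos.ne', ENNReal.ofReal_one,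
    one_mul]

theorem integrable_dotProduct_mulVec_multivariateGaussian {ι : Type*} [Fintype ι] [DecidableEq ι]
    (S B : Matrix ι ι ℝ) :
    Integrable (fun y : EuclideanSpace ℝ ι => y.ofLp ⬝ᵥ B *ᵥ y.ofLp)
      (multivariateGaussian 0 S) := by
  have hL (i : ι) : MemLp (fun y : EuclideanSpace ℝ ι => y i) 2 (multivariateGaussian 0 S) :=
    (EuclideanSpace.proj (𝕜 := ℝ) i).comp_memLp' IsGaussian.memLp_two_id
  simp only [dotProduct, Matrix.mulVec, Finset.mul_sum]
  refine integrable_finsetSum _ fun i _ => integrable_finsetSum _ fun j _ => ?_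
  refine (((hL i).integrable_mul (hL j)).const_mul (B i j)).congr (.of_forall fun y => ?_)
  simp only [Pi.mul_apply]
  ring

/-- Expand in coordinates: the mean is zero, so `y i * y j` integrates to the covariance `S i j`. -/
theorem integral_dotProduct_mulVec_multivariateGaussian {ι : Type*} [Fintype ι] [DecidableEq ι]
    {S : Matrix ι ι ℝ} (hS : S.PosSemidef) (B : Matrix ι ι ℝ) :
    ∫ y : EuclideanSpace ℝ ι, y.ofLp ⬝ᵥ B *ᵥ y.ofLp ∂(multivariateGaussian 0 S) =
      (B * S).trace := by
  have hL (i : ι) : MemLp (fun y : EuclideanSpace ℝ ι => y i) 2 (multivariateGaussian 0 S) :=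
    (EuclideanSpace.proj (𝕜 := ℝ) i).comp_memLp' IsGaussian.memLp_two_id
  have hmean (i : ι) : ∫ y : EuclideanSpace ℝ ι, y i ∂(multivariateGaussian 0 S) = 0 := by
    have := (EuclideanSpace.proj (𝕜 := ℝ) i).integral_comp_comm
      (IsGaussian.integrable_fun_id (μ := multivariateGaussian 0 S))
    simpa using this
  have hcov (i j : ι) : ∫ y : EuclideanSpace ℝ ι, y i * y j ∂(multivariateGaussian 0 S) =
      S i j := by
    have := covariance_eq_sub (hL i) (hL j)
    rw [covariance_eval_multivariateGaussian hS, hmean, hmean] at this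
    simpa using this.symm
  have hint (i j : ι) : Integrable (fun y : EuclideanSpace ℝ ι => B i j * (y i * y j))
      (multivariateGaussian 0 S) := ((hL i).integrable_mul (hL j)).const_mul (B i j)
  have hexp (y : EuclideanSpace ℝ ι) :
      y.ofLp ⬝ᵥ B *ᵥ y.ofLp = ∑ i, ∑ j, B i j * (y i * y j) := by
    simp only [dotProduct, Matrix.mulVec, Finset.mul_sum]
    exact Finset.sum_congr rfl fun i _ => Finset.sum_congr rfl fun j _ => by ring
  simp_rw [hexp]
  rw [integral_finsetSum _ fun i _ => integrable_finsetSum _ fun j _ => hint i j]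
  simp_rw [integral_finsetSum _ fun j _ => hint _ j, integral_const_mul, hcov]
  simp only [Matrix.trace, Matrix.diag, Matrix.mul_apply]
  refine Finset.sum_congr rfl fun i _ => Finset.sum_congr rfl fun j _ => ?_
  rw [show S i j = S j i by simpa using hS.isHermitian.apply j i]

end ProbabilityTheory

/-! ### Divergence computed from a density -/

namespace InformationTheory

/-- The Kullback–Leibler divergence from `ν` of a measure with positive density `f` with respect
to `ν` is the mean of `log f`. -/
theorem klDiv_of_eq_withDensity {α : Type*} [MeasurableSpace α] {μ ν : Measure α}
    [IsProbabilityMeasure μ] [IsProbabilityMeasure ν] {f : α → ℝ} (hf : Measurable f)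
    (hf0 : ∀ x, 0 < f x) (hμ : μ = ν.withDensity fun x => ENNReal.ofReal (f x))
    (hint : Integrable (fun x => Real.log (f x)) μ) :
    klDiv μ ν ≠ ∞ ∧ (klDiv μ ν).toReal = ∫ x, Real.log (f x) ∂μ := by
  have hac : μ ≪ ν := hμ ▸ withDensity_absolutelyContinuous _ _
  have hrn : μ.rnDeriv ν =ᵐ[ν] fun x => ENNReal.ofReal (f x) := by
    conv_lhs => rw [hμ]
    exact Measure.rnDeriv_withDensity ν (by fun_prop)
  have hllr : llr μ ν =ᵐ[μ] fun x => Real.log (f x) := by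
    filter_upwards [hac.ae_le hrn] with x hx
    rw [llr, hx, ENNReal.toReal_ofReal (hf0 x).le]
  refine ⟨klDiv_ne_top hac (hint.congr hllr.symm), ?_⟩
  rw [toReal_klDiv_of_measure_eq hac (by simp), integral_congr_ae hllr]

end InformationTheory

/-! ### The linear Gaussian channel -/

namespace ProbabilityTheory

variable {Ω ι κ : Type*} [MeasurableSpace Ω] {P : Measure Ω}
  [Fintype ι] [Fintype κ]
  {A : Matrix κ ι ℝ} {SX : Matrix ι ι ℝ} {SZ : Matrix κ κ ℝ}
  {X : Ω → EuclideanSpace ℝ ι} {Z : Ω → EuclideanSpace ℝ κ}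

theorem measurable_toLp_mulVec [DecidableEq ι] (A : Matrix κ ι ℝ) :
    Measurable fun x : EuclideanSpace ℝ ι => WithLp.toLp 2 (A *ᵥ x.ofLp) := by
  have := (Matrix.toLpLin 2 2 A).continuous_of_finiteDimensional.measurable
  exact this

/-- The law of `A X + Z`, for independent centred Gaussian vectors `X` and `Z`. -/
theorem map_mulVec_add_eq_multivariateGaussian [DecidableEq ι] [DecidableEq κ]
    [IsProbabilityMeasure P]
    (hSX : SX.PosSemidef) (hSZ : SZ.PosSemidef)
    (hX : HasLaw X (multivariateGaussian 0 SX) P) (hZ : HasLaw Z (multivariateGaussian 0 SZ) P)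
    (hindep : IndepFun X Z P) :
    P.map (fun ω => WithLp.toLp 2 (A *ᵥ (X ω).ofLp) + Z ω) =
      multivariateGaussian 0 (A * SX * Aᵀ + SZ) := by
  have hA := measurable_toLp_mulVec A
  have hAX : AEMeasurable (fun ω => WithLp.toLp 2 (A *ᵥ (X ω).ofLp)) P :=
    hA.comp_aemeasurable hX.aemeasurable
  have hpsd : (A * SX * Aᵀ).PosSemidef := by
    simpa using hSX.mul_mul_conjTranspose_same A
  have : IsProbabilityMeasure (P.map (fun ω => WithLp.toLp 2 (A *ᵥ (X ω).ofLp) + Z ω)) :=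
    Measure.isProbabilityMeasure_map (hAX.add hZ.aemeasurable)
  refine Measure.ext_of_charFun (funext fun t => ?_)
  have hAXlaw : charFun (P.map fun ω => WithLp.toLp 2 (A *ᵥ (X ω).ofLp)) t =
      charFun (multivariateGaussian 0 SX) (WithLp.toLp 2 (Aᵀ *ᵥ t.ofLp)) := by
    rw [charFun_apply, charFun_apply, integral_map hAX (by fun_prop), ← hX.map_eq,
      integral_map hX.aemeasurable (by fun_prop)]
    congr with ω
    congr 3
    rw [EuclideanSpace.inner_eq_star_dotProduct, EuclideanSpace.inner_eq_star_dotProduct,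
      star_trivial, star_trivial, Matrix.dotProduct_mulVec, Matrix.mulVec_transpose]
  have hindep' : IndepFun (fun ω => WithLp.toLp 2 (A *ᵥ (X ω).ofLp)) Z P :=
    hindep.comp hA measurable_id
  rw [hindep'.charFun_map_fun_add_eq_mul hAX hZ.aemeasurable, Pi.mul_apply, hAXlaw, hZ.map_eq,
    charFun_multivariateGaussian (hpsd.add hSZ), charFun_multivariateGaussian hSX,
    charFun_multivariateGaussian hSZ, ← Complex.exp_add]
  congr 1
  simp only [inner_zero_right, Complex.ofReal_zero, zero_mul, zero_sub]
  rw [Matrix.add_mulVec, dotProduct_add, ← Matrix.mulVec_mulVec, ← Matrix.mulVec_mulVec,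
    Matrix.dotProduct_mulVec _ A, Matrix.mulVec_transpose]
  push_cast
  ring

theorem posDef_mul_mul_transpose_add (A : Matrix κ ι ℝ) (hSX : SX.PosSemidef) (hSZ : SZ.PosDef) :
    (A * SX * Aᵀ + SZ).PosDef := by
  have hpsd : (A * SX * Aᵀ).PosSemidef := by
    simpa using hSX.mul_mul_conjTranspose_same A
  exact hSZ.posSemidef_add hpsd

/-- The joint law of `(X, A X + Z)` has an explicit density with respect to the product of the
marginal laws. -/
theorem map_prodMk_mulVec_add_eq_withDensity [DecidableEq ι] [DecidableEq κ]
    [IsProbabilityMeasure P] (hSX : SX.PosSemidef) (hSZ : SZ.PosDef)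
    (hX : HasLaw X (multivariateGaussian 0 SX) P) (hZ : HasLaw Z (multivariateGaussian 0 SZ) P)
    (hindep : IndepFun X Z P) :
    P.map (fun ω => (X ω, WithLp.toLp 2 (A *ᵥ (X ω).ofLp) + Z ω)) =
      ((multivariateGaussian 0 SX).prod (multivariateGaussian 0 (A * SX * Aᵀ + SZ))).withDensity
        (fun q => ENNReal.ofReal
          (multivariateGaussianDensity SZ (q.2 - WithLp.toLp 2 (A *ᵥ q.1.ofLp)) /
            multivariateGaussianDensity (A * SX * Aᵀ + SZ) q.2)) := by
  have hA := measurable_toLp_mulVec A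
  have hSY := posDef_mul_mul_transpose_add A hSX hSZ
  have hmZ := measurable_multivariateGaussianDensity SZ
  have hmY := measurable_multivariateGaussianDensity (A * SX * Aᵀ + SZ)
  have hjoint : P.map (fun ω => (X ω, WithLp.toLp 2 (A *ᵥ (X ω).ofLp) + Z ω)) =
      ((multivariateGaussian 0 SX).prod (multivariateGaussian 0 SZ)).map
        (fun q => (q.1, WithLp.toLp 2 (A *ᵥ q.1.ofLp) + q.2)) := by
    rw [← hX.map_eq, ← hZ.map_eq, ← (indepFun_iff_map_prod_eq_prod_map_map hX.aemeasurable
      hZ.aemeasurable).1 hindep, AEMeasurable.map_map_of_aemeasurable (by fun_prop)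
      (hX.aemeasurable.prodMk hZ.aemeasurable)]
    rfl
  refine Measure.ext_of_lintegral _ fun f hf => ?_
  rw [hjoint, lintegral_map hf (by fun_prop), lintegral_prod _ (by fun_prop),
    lintegral_withDensity_eq_lintegral_mul _ (by fun_prop) hf, lintegral_prod _ (by fun_prop)]
  -- By Fubini it suffices to compare the integrals over the second variable for each fixed `x`.
  refine lintegral_congr fun x => ?_
  rw [multivariateGaussian_eq_withDensity hSZ, multivariateGaussian_eq_withDensity hSY,
    lintegral_withDensity_eq_lintegral_mul _ (by fun_prop) (by fun_prop),
    lintegral_withDensity_eq_lintegral_mul _ (by fun_prop) (by fun_prop)]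
  simp only [Pi.mul_apply]
  -- Translation invariance of Lebesgue measure: substitute `y = A x + z`.
  rw [← lintegral_add_left_eq_self (fun y => ENNReal.ofReal
    (multivariateGaussianDensity (A * SX * Aᵀ + SZ) y) * _) (WithLp.toLp 2 (A *ᵥ x.ofLp))]
  refine lintegral_congr fun z => ?_
  have hpos := multivariateGaussianDensity_pos hSY (WithLp.toLp 2 (A *ᵥ x.ofLp) + z)
  rw [add_sub_cancel_left, ← mul_assoc, ← ENNReal.ofReal_mul hpos.le, mul_div_cancel₀ _ hpos.ne']

theorem log_multivariateGaussianDensity [DecidableEq κ] (hSZ : SZ.PosDef)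
    (y : EuclideanSpace ℝ κ) :
    Real.log (multivariateGaussianDensity SZ y) =
      -Real.log ((2 * Real.pi) ^ (Fintype.card κ / 2 : ℝ)) - 1 / 2 * Real.log SZ.det -
        (y.ofLp ⬝ᵥ SZ⁻¹ *ᵥ y.ofLp) / 2 := by
  have hs := Real.sqrt_pos.2 hSZ.det_pos
  have hpi : 0 < (2 * Real.pi) ^ (Fintype.card κ / 2 : ℝ) := by positivity
  rw [multivariateGaussianDensity, Real.log_mul (by positivity) (Real.exp_pos _).ne',
    Real.log_mul (by positivity) (by positivity), Real.log_inv, Real.log_inv, Real.log_exp,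
    Real.log_sqrt hSZ.det_pos.le]
  ring

/-- The mean is `trace (SZ⁻¹ * SZ)`, which depends on the dimension alone; this is what makes the
quadratic terms of noise and output cancel. -/
theorem integral_dotProduct_inv_mulVec_of_hasLaw [DecidableEq κ] (hSZ : SZ.PosDef)
    (hZ : HasLaw Z (multivariateGaussian 0 SZ) P) :
    Integrable (fun ω => (Z ω).ofLp ⬝ᵥ SZ⁻¹ *ᵥ (Z ω).ofLp) P ∧
      ∫ ω, (Z ω).ofLp ⬝ᵥ SZ⁻¹ *ᵥ (Z ω).ofLp ∂P = Fintype.card κ := by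
  have hm := measurable_dotProduct_mulVec SZ⁻¹
  have hi := integrable_dotProduct_mulVec_multivariateGaussian SZ SZ⁻¹
  have he := integral_dotProduct_mulVec_multivariateGaussian hSZ.posSemidef SZ⁻¹
  rw [← hZ.map_eq] at hi he
  rw [integrable_map_measure hm.aestronglyMeasurable hZ.aemeasurable] at hi
  rw [integral_map hZ.aemeasurable hm.aestronglyMeasurable,
    Matrix.nonsing_inv_mul _ hSZ.det_pos.ne'.isUnit, Matrix.trace_one] at he
  exact ⟨hi, he⟩

/-- The mutual information of `X` and `A X + Z`, for independent centred Gaussian vectors `X` and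
`Z` with the law of `Z` nondegenerate. -/
theorem mutualInfo_mulVec_add [DecidableEq ι] [DecidableEq κ] [IsProbabilityMeasure P]
    (hSX : SX.PosSemidef) (hSZ : SZ.PosDef)
    (hX : HasLaw X (multivariateGaussian 0 SX) P) (hZ : HasLaw Z (multivariateGaussian 0 SZ) P)
    (hindep : IndepFun X Z P) :
    mutualInfo X (fun ω => WithLp.toLp 2 (A *ᵥ (X ω).ofLp) + Z ω) P ≠ ∞ ∧
      (mutualInfo X (fun ω => WithLp.toLp 2 (A *ᵥ (X ω).ofLp) + Z ω) P).toReal =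
        1 / 2 * (Real.log (A * SX * Aᵀ + SZ).det - Real.log SZ.det) := by
  have hA := measurable_toLp_mulVec A
  have hSY := posDef_mul_mul_transpose_add A hSX hSZ
  have hmZ := measurable_multivariateGaussianDensity SZ
  have hmY := measurable_multivariateGaussianDensity (A * SX * Aᵀ + SZ)
  have hYm : AEMeasurable (fun ω => WithLp.toLp 2 (A *ᵥ (X ω).ofLp) + Z ω) P :=
    (hA.comp_aemeasurable hX.aemeasurable).add hZ.aemeasurable
  have hY : HasLaw (fun ω => WithLp.toLp 2 (A *ᵥ (X ω).ofLp) + Z ω)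
      (multivariateGaussian 0 (A * SX * Aᵀ + SZ)) P :=
    ⟨hYm, map_mulVec_add_eq_multivariateGaussian hSX hSZ.posSemidef hX hZ hindep⟩
  have hJm := hX.aemeasurable.prodMk hYm
  have hJ : IsProbabilityMeasure
      (P.map fun ω => (X ω, WithLp.toLp 2 (A *ᵥ (X ω).ofLp) + Z ω)) :=
    Measure.isProbabilityMeasure_map hJm
  set Y := fun ω => WithLp.toLp 2 (A *ᵥ (X ω).ofLp) + Z ω with hYdef
  obtain ⟨hiZ, heZ⟩ := integral_dotProduct_inv_mulVec_of_hasLaw hSZ hZ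
  obtain ⟨hiY, heY⟩ := integral_dotProduct_inv_mulVec_of_hasLaw hSY hY
  set f : EuclideanSpace ℝ ι × EuclideanSpace ℝ κ → ℝ := fun q =>
    multivariateGaussianDensity SZ (q.2 - WithLp.toLp 2 (A *ᵥ q.1.ofLp)) /
      multivariateGaussianDensity (A * SX * Aᵀ + SZ) q.2 with hf
  have hfm : Measurable f := by fun_prop
  -- Since `Y - A X = Z`, the numerator is the noise density at `Z`; the powers of `2π` cancel.
  have hlog (ω : Ω) : Real.log (f (X ω, Y ω)) =
      1 / 2 * (Real.log (A * SX * Aᵀ + SZ).det - Real.log SZ.det) -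
        ((Z ω).ofLp ⬝ᵥ SZ⁻¹ *ᵥ (Z ω).ofLp) / 2 +
        ((Y ω).ofLp ⬝ᵥ (A * SX * Aᵀ + SZ)⁻¹ *ᵥ (Y ω).ofLp) / 2 := by
    simp only [hf]
    rw [Real.log_div (multivariateGaussianDensity_pos hSZ _).ne'
      (multivariateGaussianDensity_pos hSY _).ne', log_multivariateGaussianDensity hSZ,
      log_multivariateGaussianDensity hSY]
    simp only [hYdef, add_sub_cancel_left]
    ring
  have hlogm : Measurable fun q => Real.log (f q) := by fun_prop
  have hc : Integrable (fun _ : Ω =>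
      1 / 2 * (Real.log (A * SX * Aᵀ + SZ).det - Real.log SZ.det)) P := integrable_const _
  have hcZ : Integrable (fun ω => 1 / 2 * (Real.log (A * SX * Aᵀ + SZ).det - Real.log SZ.det) -
      ((Z ω).ofLp ⬝ᵥ SZ⁻¹ *ᵥ (Z ω).ofLp) / 2) P := hc.sub (hiZ.div_const 2)
  have hint : Integrable (fun q => Real.log (f q)) (P.map fun ω => (X ω, Y ω)) := by
    rw [integrable_map_measure hlogm.aestronglyMeasurable hJm]
    exact (hcZ.add (hiY.div_const 2)).congr
      (.of_forall fun ω => (hlog ω).symm)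
  obtain ⟨h1, h2⟩ := klDiv_of_eq_withDensity hfm
    (fun q => div_pos (multivariateGaussianDensity_pos hSZ _) (multivariateGaussianDensity_pos hSY _))
    (map_prodMk_mulVec_add_eq_withDensity hSX hSZ hX hZ hindep) hint
  rw [mutualInfo, hX.map_eq, hY.map_eq]
  refine ⟨h1, h2.trans ?_⟩
  rw [integral_map hJm hlogm.aestronglyMeasurable]
  refine (integral_congr_ae (.of_forall hlog)).trans ?_
  rw [integral_add hcZ (hiY.div_const 2), integral_sub hc (hiZ.div_const 2), integral_div, integral_div, heZ, heY]
  simp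

end ProbabilityTheory

/-! ### Determinants and the spectrum of the whitened matrix -/

namespace Matrix

variable {m n : Type*} [Fintype m] [Fintype n] [DecidableEq m] [DecidableEq n]

/-- Evaluate the factored characteristic polynomial at `-1`; both sides acquire the same sign `(-1)
^ card n`. -/
theorem IsHermitian.det_one_add_eq_prod {M : Matrix n n ℝ} (hM : M.IsHermitian) :
    (1 + M).det = ∏ i, (1 + hM.eigenvalues i) := by
  have h := congrArg (Polynomial.eval (-1)) hM.charpoly_eq
  rw [eval_charpoly, Polynomial.eval_prod] at h
  have h1 : scalar n (-1 : ℝ) - M = -(1 + M) := by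
    rw [map_neg, map_one]
    abel
  rw [h1, det_neg] at h
  have h2 : ∏ i, Polynomial.eval (-1) (Polynomial.X - Polynomial.C (hM.eigenvalues i : ℝ)) =
      (-1) ^ Fintype.card n * ∏ i, (1 + hM.eigenvalues i) := by
    rw [← Finset.card_univ, ← Finset.prod_const, ← Finset.prod_mul_distrib]
    refine Finset.prod_congr rfl fun i _ => ?_
    simp
    ring
  exact mul_left_cancel₀ (pow_ne_zero _ (by norm_num)) (h.trans h2)

theorem PosDef.det_one_add_mul_inv {S : Matrix n n ℝ} (hS : S.PosDef) (B : Matrix n n ℝ) :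
    (1 + B * S⁻¹).det = (B + S).det / S.det := by
  rw [eq_div_iff hS.det_pos.ne', ← det_mul, add_mul, one_mul, Matrix.mul_assoc,
    nonsing_inv_mul _ hS.det_pos.ne'.isUnit, Matrix.mul_one, add_comm]

end Matrix

theorem whitenedSignalCov_eq_mul_conjTranspose {p n : ℕ} (A : Matrix (Fin n) (Fin p) ℝ)
    {SΘ : Matrix (Fin p) (Fin p) ℝ} (Sε : Matrix (Fin n) (Fin n) ℝ) (hSΘ : SΘ.PosSemidef) :
    whitenedSignalCov A SΘ Sε =
      ((CFC.sqrt Sε)⁻¹ * (A * CFC.sqrt SΘ)) * ((CFC.sqrt Sε)⁻¹ * (A * CFC.sqrt SΘ))ᴴ := by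
  have h1 : (CFC.sqrt Sε)⁻¹ᴴ = (CFC.sqrt Sε)⁻¹ :=
    (Matrix.nonneg_iff_posSemidef.1 (CFC.sqrt_nonneg Sε)).isHermitian.inv.eq
  have h2 : (CFC.sqrt SΘ)ᴴ = CFC.sqrt SΘ :=
    (Matrix.nonneg_iff_posSemidef.1 (CFC.sqrt_nonneg SΘ)).isHermitian.eq
  rw [Matrix.conjTranspose_mul, Matrix.conjTranspose_mul, h1, h2, whitenedSignalCov]
  conv_lhs => rw [← CFC.sqrt_mul_sqrt_self SΘ hSΘ.nonneg]
  simp only [Matrix.mul_assoc, Matrix.conjTranspose_eq_transpose_of_trivial]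

theorem rank_whitenedSignalCov {p n : ℕ} (A : Matrix (Fin n) (Fin p) ℝ)
    {SΘ : Matrix (Fin p) (Fin p) ℝ} {Sε : Matrix (Fin n) (Fin n) ℝ} (hSΘ : SΘ.PosSemidef)
    (hSε : Sε.PosDef) : (whitenedSignalCov A SΘ Sε).rank = (A * CFC.sqrt SΘ).rank := by
  rw [whitenedSignalCov_eq_mul_conjTranspose A Sε hSΘ, Matrix.rank_self_mul_conjTranspose,
    Matrix.rank_mul_eq_right_of_isUnit_det]
  exact Matrix.isUnit_nonsing_inv_det _ hSε.isUnit_det_sqrt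

/-- Moving the left factor `Sε^{-1/2}` cyclically to the right end produces `Sε⁻¹`. -/
theorem det_one_add_whitenedSignalCov {p n : ℕ} (A : Matrix (Fin n) (Fin p) ℝ)
    (SΘ : Matrix (Fin p) (Fin p) ℝ) {Sε : Matrix (Fin n) (Fin n) ℝ} (hSε : Sε.PosDef) :
    (1 + whitenedSignalCov A SΘ Sε).det = (1 + A * SΘ * Aᵀ * Sε⁻¹).det := by
  rw [whitenedSignalCov, Matrix.mul_assoc, Matrix.mul_assoc, Matrix.mul_assoc,
    Matrix.det_one_add_mul_comm, ← hSε.posSemidef.inv_sqrt_mul_inv_sqrt]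
  simp only [Matrix.mul_assoc]

theorem lemma3p1 {Ω : Type*} [MeasurableSpace Ω] (P : Measure Ω) [IsProbabilityMeasure P]
    (p n : ℕ) (A : Matrix (Fin n) (Fin p) ℝ)
    (SΘ : Matrix (Fin p) (Fin p) ℝ) (Sε : Matrix (Fin n) (Fin n) ℝ)
    (hSΘ : SΘ.PosSemidef) (hSε : Sε.PosDef)
    (Θ : Ω → EuclideanSpace ℝ (Fin p)) (ε Y : Ω → EuclideanSpace ℝ (Fin n))
    (hΘ : HasLaw Θ (multivariateGaussian 0 SΘ) P)
    (hε : HasLaw ε (multivariateGaussian 0 Sε) P)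
    (hindep : IndepFun Θ ε P)
    (hY : ∀ ω, Y ω = WithLp.toLp 2 (A *ᵥ (Θ ω).ofLp) + ε ω) :
    HasGaussianLaw (fun ω => (Θ ω, Y ω)) P ∧
    mutualInfo Θ Y P ≠ ∞ ∧
    0 < (1 + A * SΘ * Aᵀ * Sε⁻¹).det ∧
    (mutualInfo Θ Y P).toReal = 1 / 2 * Real.log (1 + A * SΘ * Aᵀ * Sε⁻¹).det ∧
    0 < (1 + SΘ * Aᵀ * Sε⁻¹ * A).det ∧
    (mutualInfo Θ Y P).toReal = 1 / 2 * Real.log (1 + SΘ * Aᵀ * Sε⁻¹ * A).det ∧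
    ∃ hM : (whitenedSignalCov A SΘ Sε).IsHermitian,
      (∀ j, hM.eigenvalues j ≠ 0 → 0 < hM.eigenvalues j) ∧
      (Finset.univ.filter (fun j => hM.eigenvalues j ≠ 0)).card = (A * CFC.sqrt SΘ).rank ∧
      (mutualInfo Θ Y P).toReal =
        1 / 2 * ∑ j ∈ Finset.univ.filter (fun j => hM.eigenvalues j ≠ 0),
          Real.log (1 + hM.eigenvalues j) := by
  have hYeq : Y = fun ω => WithLp.toLp 2 (A *ᵥ (Θ ω).ofLp) + ε ω := funext hY
  have hSY := posDef_mul_mul_transpose_add A hSΘ hSε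
  have hgauss : HasGaussianLaw (fun ω => (Θ ω, Y ω)) P := by
    -- `(Θ, Y)` is the image of the Gaussian pair `(Θ, ε)` under the linear map `(x, z) ↦ (x, A x +
    -- z)`.
    let L : EuclideanSpace ℝ (Fin p) →L[ℝ] EuclideanSpace ℝ (Fin n) :=
      (Matrix.toLpLin 2 2 A).toContinuousLinearMap
    have h := (hindep.hasGaussianLaw hΘ.hasGaussianLaw hε.hasGaussianLaw).map_fun
      ((ContinuousLinearMap.fst ℝ _ _).prod
        (L.comp (ContinuousLinearMap.fst ℝ _ _) + ContinuousLinearMap.snd ℝ _ _))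
    rw [hYeq]
    exact h
  obtain ⟨hfin, hI⟩ := mutualInfo_mulVec_add (A := A) hSΘ hSε hΘ hε hindep
  rw [← hYeq] at hfin hI
  have hdet := hSε.det_one_add_mul_inv (A * SΘ * Aᵀ)
  have hpos : 0 < (1 + A * SΘ * Aᵀ * Sε⁻¹).det := hdet ▸ div_pos hSY.det_pos hSε.det_pos
  have hI' : (mutualInfo Θ Y P).toReal =
      1 / 2 * Real.log (1 + A * SΘ * Aᵀ * Sε⁻¹).det := by
    rw [hI, hdet, Real.log_div hSY.det_pos.ne' hSε.det_pos.ne']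
  have hcomm : (1 + SΘ * Aᵀ * Sε⁻¹ * A).det = (1 + A * SΘ * Aᵀ * Sε⁻¹).det := by
    rw [Matrix.det_one_add_mul_comm]
    simp only [Matrix.mul_assoc]
  have hpsd : (whitenedSignalCov A SΘ Sε).PosSemidef := by
    rw [whitenedSignalCov_eq_mul_conjTranspose A Sε hSΘ]
    exact Matrix.posSemidef_self_mul_conjTranspose _
  refine ⟨hgauss, hfin, hpos, hI', hcomm ▸ hpos, hcomm ▸ hI', hpsd.isHermitian,
    fun j hj => lt_of_le_of_ne (hpsd.eigenvalues_nonneg j) hj.symm, ?_, ?_⟩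
  · rw [← rank_whitenedSignalCov A hSΘ hSε, hpsd.isHermitian.rank_eq_card_non_zero_eigs,
      Fintype.card_subtype]
  · rw [hI', ← det_one_add_whitenedSignalCov A SΘ hSε, hpsd.isHermitian.det_one_add_eq_prod,
      Real.log_prod fun i _ => (by linarith [hpsd.eigenvalues_nonneg i] : 0 < 1 + hpsd.isHermitian.eigenvalues i).ne']
    -- Zero eigenvalues contribute `log 1 = 0`, so the full sum equals the filtered one.
    rw [Finset.sum_filter_of_ne]
    intro i _ hi h0
    simp [h0] at hi
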